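/- **Setting.** Formulas are built from denumerably many atoms $p,q,\dots$ by $\neg,\Box,\land,\lor$. A sequent $\Gamma\Rightarrow\Delta$ is an ordered pair of finite sets of formulas ($\Gamma,\phi$ stands for $\Gamma\cup\{\phi\}$; either side may be empty), and a hypersequent $S_1\sslash\dots\sslash S_n$ is a finite list of sequents. A Kripke model is a set $W$ with a binary relation $R$ and a valuation $v$ of formulas at points in $\{0,1\}$ obeying the usual Boolean clauses and $v(\Box\phi,x)=1$ iff $v(\phi,y)=1$ for all $y$ with $xRy$. It is a *countermodel* to $\Gamma_1\Rightarrow\Delta_1\sslash\dots\sslash\Gamma_n\Rightarrow\Delta_n$ if there are points $w_1,\dots,w_n$ with $w_iRw_{i+1}$ for $1\le i\le n-1$ such that, for every $i$, $v(\phi,w_i)=1$ for all $\phi\in\Gamma_i$ and $v(\psi,w_i)=0$ for all $\psi\in\Delta_i$. We write $\vDash_{\mathbf{K4}}H$ if no Kripke model with transitive $R$ is a countermodel to $H$. The calculus $\mathrm{RK4_{Cut}}$ has the following axiom and rules (premises before "/", conclusion after it), where $p$ is an atom, $\phi,\psi$ are formulas, $\Gamma,\Delta,\Sigma,\Lambda$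 are finite sets of formulas, and $G,H$ are possibly empty lists of sequents. - $\mathrm{Id}$: $\;p\Rightarrow p$. - $\mathrm{Cut}$: $\;G\sslash\Gamma\Rightarrow\phi,\Delta\sslash H$ and $G\sslash\Gamma,\phi\Rightarrow\Delta\sslash H$ / $G\sslash\Gamma\Rightarrow\Delta\sslash H$. - External weakening $EW\mathrm L$: $\;G$ / ${\Rightarrow}\sslash G$; $EW\mathrm R$: $\;G$ / $G\sslash{\Rightarrow}$; $EW$: $\;G\sslash H$ / $G\sslash{\Rightarrow}\sslash H$. - Internal weakening $T\mathrm L$: $\;G\sslash\Gamma\Rightarrow\Delta\sslash H$ / $G\sslash\Gamma,\phi\Rightarrow\Delta\sslash H$; $T\mathrm R$: $\;G\sslash\Gamma\Rightarrow\Delta\sslash H$ / $G\sslash\Gamma\Rightarrow\phi,\Delta\sslash H$. - $\Box\mathrm R$: $\;G\sslash\Gamma\Rightarrow\Delta\sslash{\Rightarrow}\phi$ / $G\sslash\Gamma\Rightarrow\Box\phi,\Delta$. - $\Box\mathrm L$: $\;G\sslash\Gamma\Rightarrow\Delta\sslash\Sigma,\phi\Rightarrow\Lambda\sslash H$ / $G\sslash\Gamma,\Box\phi\Rightarrow\Delta\sslash\Sigma\Rightarrow\Lambda\sslash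 H$. - $\neg\mathrm L$: $\;G\sslash\Gamma\Rightarrow\Delta,\phi\sslash H$ / $G\sslash\Gamma,\neg\phi\Rightarrow\Delta\sslash H$; $\neg\mathrm R$: $\;G\sslash\Gamma,\phi\Rightarrow\Delta\sslash H$ / $G\sslash\Gamma\Rightarrow\neg\phi,\Delta\sslash H$. - $\land\mathrm L_1$, $\land\mathrm L_2$: $\;G\sslash\Gamma,\phi\Rightarrow\Delta\sslash H$, respectively $G\sslash\Gamma,\psi\Rightarrow\Delta\sslash H$ / $G\sslash\Gamma,\phi\land\psi\Rightarrow\Delta\sslash H$. - $\land\mathrm R$: $\;G\sslash\Gamma\Rightarrow\phi,\Delta\sslash H$ and $G\sslash\Gamma\Rightarrow\psi,\Delta\sslash H$ / $G\sslash\Gamma\Rightarrow\phi\land\psi,\Delta\sslash H$. - $\lor\mathrm L$: $\;G\sslash\Gamma,\phi\Rightarrow\Delta\sslash H$ and $G\sslash\Gamma,\psi\Rightarrow\Delta\sslash H$ / $G\sslash\Gamma,\phi\lor\psi\Rightarrow\Delta\sslash H$. - $\lor\mathrm R_1$, $\lor\mathrm R_2$: $\;G\sslash\Gamma\Rightarrow\Delta,\phi\sslash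 H$, respectively $G\sslash\Gamma\Rightarrow\Delta,\psi\sslash H$ / $G\sslash\Gamma\Rightarrow\Delta,\phi\lor\psi\sslash H$. We write $\vdash_{\mathrm{RK4_{Cut}}}H$ if $H$ has a derivation in this calculus. **Theorem.** $\mathrm{RK4_{Cut}}$ is hypersequent complete for transitive frames: for every hypersequent $H$, if $\vDash_{\mathbf{K4}}H$ then $\vdash_{\mathrm{RK4_{Cut}}}H$. -/

import Mathlib

namespace RelHyp

/-- Modal formulas over denumerably many atoms (indexed by `ℕ`). -/
inductive Formula : Type
  | atom : ℕ → Formula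
  | neg : Formula → Formula
  | box : Formula → Formula
  | and : Formula → Formula → Formula
  | or : Formula → Formula → Formula
  deriving DecidableEq

/-- A sequent `Γ ⇒ Δ`: an ordered pair of finite sets of formulas. -/
structure Sequent : Type where
  ant : Finset Formula
  suc : Finset Formula

/-- A hypersequent `S₁ // … // Sₙ`: a finite list of sequents. -/
abbrev Hypersequent : Type := List Sequent

/-- A Kripke frame: a type of points with a binary accessibility relation. -/
structure KripkeFrame : Type 1 where
  World : Type
  R : World → World → Prop

/-- A Kripke model: a frame with a valuation of the atoms at its points. -/
structure KripkeModel : Type 1 extends KripkeFrame where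
  val : ℕ → World → Prop

/-- Truth of a formula at a point: the unique extension of the valuation of the atoms that obeys
the clauses for the connectives. `M.Sat φ x` is `v(φ, x) = 1`, and its negation is
`v(φ, x) = 0`. -/
def KripkeModel.Sat (M : KripkeModel) : Formula → M.World → Prop
  | .atom n, x => M.val n x
  | .neg φ, x => ¬ M.Sat φ x
  | .box φ, x => ∀ y, M.R x y → M.Sat φ y
  | .and φ ψ, x => M.Sat φ x ∧ M.Sat ψ x
  | .or φ ψ, x => M.Sat φ x ∨ M.Sat ψ x

/-- `M` is a countermodel to the sequent `S` at the point `w`. -/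
def KripkeModel.RefutesAt (M : KripkeModel) (S : Sequent) (w : M.World) : Prop :=
  (∀ φ ∈ S.ant, M.Sat φ w) ∧ (∀ ψ ∈ S.suc, ¬ M.Sat ψ w)

/-- `M` is a countermodel to the hypersequent `S₁ // … // Sₙ`: there is a branch of points
`w₁, …, wₙ` (that is, `wᵢ R wᵢ₊₁` for `1 ≤ i ≤ n - 1`) such that `M` is a countermodel to `Sᵢ`
at `wᵢ` for every `i`. -/
def KripkeModel.IsCountermodel (M : KripkeModel) (H : Hypersequent) : Prop :=
  ∃ ws : List M.World, ws.IsChain M.R ∧ List.Forall₂ M.RefutesAt H ws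

/-- `H` is valid in a class of frames: no model on a frame of the class is a countermodel. -/
def Valid (C : KripkeFrame → Prop) (H : Hypersequent) : Prop :=
  ∀ M : KripkeModel, C M.toKripkeFrame → ¬ M.IsCountermodel H

/-- The class of **K4** frames: the accessibility relation is transitive. -/
def IsK4Frame (F : KripkeFrame) : Prop :=
  ∀ x y z : F.World, F.R x y → F.R y z → F.R x z

/-- Derivability in `RK4` with `Cut` as a primitive rule: the rules of `RK` (with `Cut`) together
with the external structural rule `EW`. Sequents consist of sets, so `Γ, φ` is `Γ ∪ {φ}`. -/
inductive RK4Cut : Hypersequent → Prop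
  | id (p : ℕ) : RK4Cut [⟨{.atom p}, {.atom p}⟩]
  | cut (G H : Hypersequent) (Γ Δ : Finset Formula) (φ : Formula) :
      RK4Cut (G ++ ⟨Γ, insert φ Δ⟩ :: H) → RK4Cut (G ++ ⟨insert φ Γ, Δ⟩ :: H) →
      RK4Cut (G ++ ⟨Γ, Δ⟩ :: H)
  | ewL (G : Hypersequent) : RK4Cut G → RK4Cut (⟨∅, ∅⟩ :: G)
  | ewR (G : Hypersequent) : RK4Cut G → RK4Cut (G ++ [⟨∅, ∅⟩])
  | ew (G H : Hypersequent) : RK4Cut (G ++ H) → RK4Cut (G ++ ⟨∅, ∅⟩ :: H)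
  | tL (G H : Hypersequent) (Γ Δ : Finset Formula) (φ : Formula) :
      RK4Cut (G ++ ⟨Γ, Δ⟩ :: H) → RK4Cut (G ++ ⟨insert φ Γ, Δ⟩ :: H)
  | tR (G H : Hypersequent) (Γ Δ : Finset Formula) (φ : Formula) :
      RK4Cut (G ++ ⟨Γ, Δ⟩ :: H) → RK4Cut (G ++ ⟨Γ, insert φ Δ⟩ :: H)
  | boxR (G : Hypersequent) (Γ Δ : Finset Formula) (φ : Formula) :
      RK4Cut (G ++ [⟨Γ, Δ⟩, ⟨∅, {φ}⟩]) → RK4Cut (G ++ [⟨Γ, insert (.box φ) Δ⟩])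
  | boxL (G H : Hypersequent) (Γ Δ Θ Λ : Finset Formula) (φ : Formula) :
      RK4Cut (G ++ ⟨Γ, Δ⟩ :: ⟨insert φ Θ, Λ⟩ :: H) →
      RK4Cut (G ++ ⟨insert (.box φ) Γ, Δ⟩ :: ⟨Θ, Λ⟩ :: H)
  | negL (G H : Hypersequent) (Γ Δ : Finset Formula) (φ : Formula) :
      RK4Cut (G ++ ⟨Γ, insert φ Δ⟩ :: H) → RK4Cut (G ++ ⟨insert (.neg φ) Γ, Δ⟩ :: H)
  | negR (G H : Hypersequent) (Γ Δ : Finset Formula) (φ : Formula) :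
      RK4Cut (G ++ ⟨insert φ Γ, Δ⟩ :: H) → RK4Cut (G ++ ⟨Γ, insert (.neg φ) Δ⟩ :: H)
  | andL₁ (G H : Hypersequent) (Γ Δ : Finset Formula) (φ ψ : Formula) :
      RK4Cut (G ++ ⟨insert φ Γ, Δ⟩ :: H) → RK4Cut (G ++ ⟨insert (.and φ ψ) Γ, Δ⟩ :: H)
  | andL₂ (G H : Hypersequent) (Γ Δ : Finset Formula) (φ ψ : Formula) :
      RK4Cut (G ++ ⟨insert ψ Γ, Δ⟩ :: H) → RK4Cut (G ++ ⟨insert (.and φ ψ) Γ, Δ⟩ :: H)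
  | andR (G H : Hypersequent) (Γ Δ : Finset Formula) (φ ψ : Formula) :
      RK4Cut (G ++ ⟨Γ, insert φ Δ⟩ :: H) → RK4Cut (G ++ ⟨Γ, insert ψ Δ⟩ :: H) →
      RK4Cut (G ++ ⟨Γ, insert (.and φ ψ) Δ⟩ :: H)
  | orL (G H : Hypersequent) (Γ Δ : Finset Formula) (φ ψ : Formula) :
      RK4Cut (G ++ ⟨insert φ Γ, Δ⟩ :: H) → RK4Cut (G ++ ⟨insert ψ Γ, Δ⟩ :: H) →
      RK4Cut (G ++ ⟨insert (.or φ ψ) Γ, Δ⟩ :: H)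
  | orR₁ (G H : Hypersequent) (Γ Δ : Finset Formula) (φ ψ : Formula) :
      RK4Cut (G ++ ⟨Γ, insert φ Δ⟩ :: H) → RK4Cut (G ++ ⟨Γ, insert (.or φ ψ) Δ⟩ :: H)
  | orR₂ (G H : Hypersequent) (Γ Δ : Finset Formula) (φ ψ : Formula) :
      RK4Cut (G ++ ⟨Γ, insert ψ Δ⟩ :: H) → RK4Cut (G ++ ⟨Γ, insert (.or φ ψ) Δ⟩ :: H)

end RelHyp

/-!
The contrapositive is proved by building a canonical countermodel. Let `F` be a finite set
containing all subformulas of an underivable hypersequent `H`. By `Cut`, any formula can be put on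
one side of any component without making the hypersequent derivable, so `H` extends to an
underivable `H'` each of whose components decides every formula of `F`
(`exists_saturated_of_not_derivable`).

The worlds of the canonical model are the underivable sequents that decide every formula of `F`;
`u` is accessible from `w` when every `□φ ∈ F` on the left of `w` has both `φ` and `□φ` on the left
of `u`, which makes accessibility transitive. Two consecutive components of `H'` are related,
because `□φ ⇒ // ⇒ φ` and `□φ ⇒ // ⇒ □φ` are derivable (`derivable_box_left`,
`derivable_box_box`; the second is where `EW` is needed). Hence `H'` is a branch of the model, and
the truth lemma (`truth_lemma`) shows that it refutes `H`. In the truth lemma, `□φ` on the right of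
`w` is refuted because by `□R` the hypersequent `w // ⇒ φ` is underivable, and saturating it yields
a world accessible from `w`.
-/

namespace RelHyp

/-! ### Weakening -/

/-- Componentwise inclusion of sequents. -/
def Sequent.Sub (S T : Sequent) : Prop := S.ant ⊆ T.ant ∧ S.suc ⊆ T.suc

theorem Sequent.Sub.refl (S : Sequent) : S.Sub S := ⟨subset_rfl, subset_rfl⟩

theorem Sequent.Sub.trans {S T U : Sequent} (h : S.Sub T) (h' : T.Sub U) : S.Sub U :=
  ⟨h.1.trans h'.1, h.2.trans h'.2⟩

theorem RK4Cut.weaken_sequent {G H : Hypersequent} {S T : Sequent} (hST : S.Sub T)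
    (h : RK4Cut (G ++ S :: H)) : RK4Cut (G ++ T :: H) := by
  obtain ⟨Γ, Δ⟩ := S
  obtain ⟨Γ', Δ'⟩ := T
  obtain ⟨hΓ, hΔ⟩ : Γ ⊆ Γ' ∧ Δ ⊆ Δ' := hST
  have hL : ∀ s : Finset Formula, RK4Cut (G ++ ⟨s ∪ Γ, Δ⟩ :: H) := fun s => by
    induction s using Finset.induction_on with
    | empty => simpa using h
    | insert φ s _ ih => rw [Finset.insert_union]; exact .tL _ _ _ _ _ ih
  have hR : ∀ s : Finset Formula, RK4Cut (G ++ ⟨Γ', s ∪ Δ⟩ :: H) := fun s => by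
    induction s using Finset.induction_on with
    | empty => simpa [Finset.union_eq_left.2 hΓ] using hL Γ'
    | insert φ s _ ih => rw [Finset.insert_union]; exact .tR _ _ _ _ _ ih
  simpa [Finset.union_eq_left.2 hΔ] using hR Δ'

theorem RK4Cut.weaken_internal {X Y : Hypersequent} (hXY : List.Forall₂ Sequent.Sub X Y) :
    ∀ G : Hypersequent, RK4Cut (G ++ X) → RK4Cut (G ++ Y) := by
  induction hXY with
  | nil => exact fun _ h => h
  | @cons S T X Y hST _ ih =>
    intro G h
    have := ih (G ++ [T]) (by simpa using h.weaken_sequent hST)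
    simpa using this

theorem RK4Cut.weaken_left {X : Hypersequent} (h : RK4Cut X) :
    ∀ G : Hypersequent, RK4Cut (G ++ X)
  | [] => h
  | S :: G => by
    have := RK4Cut.ewL _ (h.weaken_left G)
    exact RK4Cut.weaken_sequent (G := []) (T := S) (by simp [Sequent.Sub]) this

theorem RK4Cut.weaken_right {X : Hypersequent} (h : RK4Cut X) (H : Hypersequent) :
    RK4Cut (X ++ H) := by
  induction H generalizing X with
  | nil => simpa using h
  | cons S H ih =>
    have := RK4Cut.weaken_sequent (H := []) (T := S) (by simp [Sequent.Sub]) (RK4Cut.ewR _ h)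
    simpa using ih this

/-- A hypersequent is derivable as soon as some consecutive run of its components extends a
derivable hypersequent. -/
theorem RK4Cut.weaken {X Y : Hypersequent} (h : RK4Cut X) (hXY : List.Forall₂ Sequent.Sub X Y)
    (G H : Hypersequent) : RK4Cut (G ++ (Y ++ H)) :=
  ((RK4Cut.weaken_internal hXY [] h).weaken_right H).weaken_left G

/-! ### Derivable hypersequents -/

/-- The axiom `Id` holds for all formulas. -/
theorem derivable_id : ∀ φ : Formula, RK4Cut [⟨{φ}, {φ}⟩]
  | .atom p => .id p
  | .neg φ => by
    have h : RK4Cut [⟨insert φ ∅, insert φ ∅⟩] := derivable_id φ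
    have h₁ : RK4Cut [⟨{.neg φ, φ}, ∅⟩] := .negL [] [] _ _ _ h
    rw [Finset.pair_comm] at h₁
    exact .negR [] [] _ _ _ h₁
  | .box φ => by
    have h : RK4Cut [⟨∅, ∅⟩, ⟨insert φ ∅, {φ}⟩] := .ewL _ (derivable_id φ)
    exact .boxR [] _ _ _ (.boxL [] [] _ _ _ _ _ h)
  | .and φ ψ =>
    .andR [] [] _ ∅ _ _ (.andL₁ [] [] ∅ _ _ _ (derivable_id φ))
      (.andL₂ [] [] ∅ _ _ _ (derivable_id ψ))
  | .or φ ψ =>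
    .orL [] [] ∅ _ _ _ (.orR₁ [] [] _ ∅ _ _ (derivable_id φ))
      (.orR₂ [] [] _ ∅ _ _ (derivable_id ψ))

theorem derivable_box_left (φ : Formula) : RK4Cut [⟨{.box φ}, ∅⟩, ⟨∅, {φ}⟩] :=
  .boxL [] [] ∅ _ _ _ _ (.ewL _ (derivable_id φ))

/-- The hypersequent form of the axiom `□φ → □□φ`. -/
theorem derivable_box_box (φ : Formula) : RK4Cut [⟨{.box φ}, ∅⟩, ⟨∅, {.box φ}⟩] :=
  .boxR [_] ∅ ∅ _ (.ew [_] [_] (derivable_box_left φ))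

theorem derivable_of_mem {φ : Formula} {Γ Δ : Finset Formula} (hΓ : φ ∈ Γ) (hΔ : φ ∈ Δ) :
    RK4Cut [⟨Γ, Δ⟩] :=
  (derivable_id φ).weaken (.cons (by simp [Sequent.Sub, hΓ, hΔ]) .nil) [] []

/-! ### Saturation -/

/-- A sequent decides every formula of `F`: each occurs on its left or on its right. -/
def Sequent.Saturated (F : Finset Formula) (S : Sequent) : Prop :=
  ∀ φ ∈ F, φ ∈ S.ant ∨ φ ∈ S.suc

theorem exists_saturated_component (F : Finset Formula) {G H : Hypersequent} {S : Sequent}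
    (h : ¬ RK4Cut (G ++ S :: H)) :
    ∃ T : Sequent, S.Sub T ∧ T.Saturated F ∧ ¬ RK4Cut (G ++ T :: H) := by
  induction F using Finset.induction_on with
  | empty => exact ⟨S, .refl S, by simp [Sequent.Saturated], h⟩
  | insert φ F _ ih =>
    obtain ⟨⟨Γ, Δ⟩, hS, hF, hT⟩ := ih
    by_cases hφ : RK4Cut (G ++ ⟨Γ, insert φ Δ⟩ :: H)
    · refine ⟨⟨insert φ Γ, Δ⟩, hS.trans ⟨Finset.subset_insert _ _, subset_rfl⟩, fun ψ hψ => ?_,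
        fun h' => hT (.cut _ _ _ _ _ hφ h')⟩
      obtain rfl | hψ := Finset.mem_insert.1 hψ
      · simp
      · exact (hF ψ hψ).imp (Finset.mem_insert_of_mem) id
    · refine ⟨⟨Γ, insert φ Δ⟩, hS.trans ⟨subset_rfl, Finset.subset_insert _ _⟩, fun ψ hψ => ?_, hφ⟩
      obtain rfl | hψ := Finset.mem_insert.1 hψ
      · simp
      · exact (hF ψ hψ).imp id (Finset.mem_insert_of_mem)

theorem exists_saturated_append (F : Finset Formula) (H : Hypersequent) :
    ∀ G : Hypersequent, ¬ RK4Cut (G ++ H) →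
      ∃ H' : Hypersequent, List.Forall₂ Sequent.Sub H H' ∧ (∀ S ∈ H', S.Saturated F) ∧
        ¬ RK4Cut (G ++ H') := by
  induction H with
  | nil => exact fun G h => ⟨[], .nil, by simp, h⟩
  | cons S H ih =>
    intro G h
    obtain ⟨T, hST, hT, hd⟩ := exists_saturated_component F h
    obtain ⟨H', hHH', hH', hd'⟩ := ih (G ++ [T]) (by simpa using hd)
    exact ⟨T :: H', .cons hST hHH', List.forall_mem_cons.2 ⟨hT, hH'⟩, by simpa using hd'⟩

theorem exists_saturated_of_not_derivable (F : Finset Formula) {H : Hypersequent}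
    (h : ¬ RK4Cut H) :
    ∃ H' : Hypersequent, List.Forall₂ Sequent.Sub H H' ∧ (∀ S ∈ H', S.Saturated F) ∧
      ¬ RK4Cut H' :=
  exists_saturated_append F H [] h

/-! ### The canonical model -/

/-- The worlds of the canonical model over `F`: underivable sequents deciding all of `F`. Such a
sequent may also contain formulas outside `F`; they play no role. -/
abbrev CanonicalWorld (F : Finset Formula) : Type :=
  {S : Sequent // ¬ RK4Cut [S] ∧ S.Saturated F}

/-- The canonical model over `F`. Requiring `□φ` as well as `φ` at the accessible world is what
makes the accessibility relation transitive. -/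
def canonicalModel (F : Finset Formula) : KripkeModel where
  World := CanonicalWorld F
  R w u := ∀ φ, .box φ ∈ F → .box φ ∈ w.1.ant → φ ∈ u.1.ant ∧ .box φ ∈ u.1.ant
  val n w := .atom n ∈ w.1.ant

theorem isK4Frame_canonicalModel (F : Finset Formula) :
    IsK4Frame (canonicalModel F).toKripkeFrame :=
  fun _ _ _ hxy hyz φ hF hφ => hyz φ hF (hxy φ hF hφ).2

/-- The set of subformulas of a formula, itself included. -/
def Formula.subformulas : Formula → Finset Formula
  | .atom n => {.atom n}
  | .neg φ => insert (.neg φ) φ.subformulas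
  | .box φ => insert (.box φ) φ.subformulas
  | .and φ ψ => insert (.and φ ψ) (φ.subformulas ∪ ψ.subformulas)
  | .or φ ψ => insert (.or φ ψ) (φ.subformulas ∪ ψ.subformulas)

theorem Formula.self_mem_subformulas (φ : Formula) : φ ∈ φ.subformulas := by
  cases φ <;> simp [subformulas]

theorem Formula.subformulas_subset {φ ψ : Formula} (h : φ ∈ ψ.subformulas) :
    φ.subformulas ⊆ ψ.subformulas := by
  induction ψ with
  | atom n =>
    rw [Finset.mem_singleton.1 h]
  | neg ψ ih | box ψ ih =>
    obtain rfl | h := Finset.mem_insert.1 h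
    · rfl
    · exact (ih h).trans (Finset.subset_insert _ _)
  | and ψ χ ihψ ihχ | or ψ χ ihψ ihχ =>
    obtain rfl | h := Finset.mem_insert.1 h
    · rfl
    · refine Finset.Subset.trans ?_ (Finset.subset_insert _ _)
      obtain h | h := Finset.mem_union.1 h
      · exact (ihψ h).trans Finset.subset_union_left
      · exact (ihχ h).trans Finset.subset_union_right

theorem exists_finset_subformula_closed (H : Hypersequent) :
    ∃ F : Finset Formula, (∀ φ ∈ F, φ.subformulas ⊆ F) ∧ ∀ S ∈ H, S.ant ∪ S.suc ⊆ F := by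
  induction H with
  | nil => exact ⟨∅, by simp⟩
  | cons S H ih =>
    obtain ⟨F, hF, hH⟩ := ih
    refine ⟨(S.ant ∪ S.suc).biUnion Formula.subformulas ∪ F, fun φ hφ => ?_,
      List.forall_mem_cons.2 ⟨fun φ hφ => ?_, fun T hT => ?_⟩⟩
    · obtain hφ | hφ := Finset.mem_union.1 hφ
      · obtain ⟨ψ, hψ, hφ⟩ := Finset.mem_biUnion.1 hφ
        exact (Formula.subformulas_subset hφ).trans
          ((Finset.subset_biUnion_of_mem _ hψ).trans Finset.subset_union_left)
      · exact (hF φ hφ).trans Finset.subset_union_right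
    · exact Finset.mem_union_left _ (Finset.mem_biUnion.2 ⟨φ, hφ, φ.self_mem_subformulas⟩)
    · exact (hH T hT).trans Finset.subset_union_right

/-- Consecutive saturated components of an underivable hypersequent satisfy the accessibility
condition of the canonical model. -/
theorem mem_ant_of_box_mem_ant {F : Finset Formula} {G H : Hypersequent} {S T : Sequent}
    (h : ¬ RK4Cut (G ++ S :: T :: H)) (hT : T.Saturated F) {φ : Formula} (hφ : φ ∈ F)
    (hbox : .box φ ∈ F) (hS : .box φ ∈ S.ant) : φ ∈ T.ant ∧ .box φ ∈ T.ant := by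
  refine ⟨(hT _ hφ).resolve_right fun h' => h ?_, (hT _ hbox).resolve_right fun h' => h ?_⟩
  · exact (derivable_box_left φ).weaken (Y := [S, T])
      (.cons (by simp [Sequent.Sub, hS]) (.cons (by simp [Sequent.Sub, h']) .nil)) G H
  · exact (derivable_box_box φ).weaken (Y := [S, T])
      (.cons (by simp [Sequent.Sub, hS]) (.cons (by simp [Sequent.Sub, h']) .nil)) G H

/-- The components of an underivable saturated hypersequent form a branch of the canonical model. -/
theorem exists_branch {F : Finset Formula} (hF : ∀ φ, .box φ ∈ F → φ ∈ F) {H : Hypersequent}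
    (hH : ¬ RK4Cut H) (hsat : ∀ S ∈ H, S.Saturated F) :
    ∃ ws : List (CanonicalWorld F), ws.map Subtype.val = H ∧ ws.IsChain (canonicalModel F).R := by
  have hW : ∀ S ∈ H, ¬ RK4Cut [S] ∧ S.Saturated F := fun S hS => by
    refine ⟨fun h => hH ?_, hsat S hS⟩
    obtain ⟨G, K, rfl⟩ := List.append_of_mem hS
    exact h.weaken (.cons (.refl S) .nil) G K
  lift H to List (CanonicalWorld F) using hW
  refine ⟨H, rfl,
    (List.isChain_iff_forall_rel_of_append_cons_cons (α := CanonicalWorld F)).2 ?_⟩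
  rintro w u G K rfl φ hbox hw
  exact mem_ant_of_box_mem_ant (by simpa using hH) u.2.2 (hF φ hbox) hbox hw

theorem truth_lemma {F : Finset Formula} (hF : ∀ φ, .box φ ∈ F → φ ∈ F) (φ : Formula)
    (hφ : φ.subformulas ⊆ F) (w : CanonicalWorld F) :
    (φ ∈ w.1.ant → (canonicalModel F).Sat φ w) ∧ (φ ∈ w.1.suc → ¬ (canonicalModel F).Sat φ w) := by
  induction φ generalizing w with
  | atom n => exact ⟨id, fun h h' => w.2.1 (derivable_of_mem h' h)⟩
  | neg φ ih =>
    obtain ⟨⟨Γ, Δ⟩, hd, hw⟩ := w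
    have hφ' : φ.subformulas ⊆ F := (Finset.subset_insert _ _).trans hφ
    have ih := ih hφ' ⟨⟨Γ, Δ⟩, hd, hw⟩
    have hmem := hw φ (hφ' φ.self_mem_subformulas)
    refine ⟨fun h => ih.2 (hmem.resolve_left fun hΓ => hd ?_),
      fun h => not_not_intro (ih.1 (hmem.resolve_right fun hΔ => hd ?_))⟩
    · rw [← Finset.insert_eq_of_mem (s := Γ) h]
      exact .negL [] [] _ _ _ (derivable_of_mem hΓ (Finset.mem_insert_self _ _))
    · rw [← Finset.insert_eq_of_mem (s := Δ) h]
      exact .negR [] [] _ _ _ (derivable_of_mem (Finset.mem_insert_self _ _) hΔ)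
  | box φ ih =>
    have hφ' : φ.subformulas ⊆ F := (Finset.subset_insert _ _).trans hφ
    have hbox : .box φ ∈ F := hφ (Formula.self_mem_subformulas _)
    refine ⟨fun h u hu => (ih hφ' u).1 (hu φ hbox h).1, fun h hsat => ?_⟩
    have hd : ¬ RK4Cut [w.1, ⟨∅, {φ}⟩] := fun h' => w.2.1 <| by
      have := RK4Cut.boxR [] _ _ _ h'
      rwa [Finset.insert_eq_of_mem h] at this
    obtain ⟨H', hsub, hH', hd'⟩ := exists_saturated_of_not_derivable F hd
    obtain ⟨ws, rfl, hchain⟩ := exists_branch hF hd' hH'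
    -- The first world of the branch only extends `w`, but all that accessibility of the second
    -- world `u` from `w` asks is the inclusion of the left sides.
    match ws, hsub, hchain with
    | [w', u], .cons hww' (.cons hu .nil), hchain =>
      refine (ih hφ' u).2 (hu.2 (Finset.mem_singleton_self φ)) (hsat u fun ψ hψ hψw => ?_)
      exact (List.isChain_pair.1 hchain) ψ hψ (hww'.1 hψw)
  | and φ ψ ihφ ihψ =>
    obtain ⟨⟨Γ, Δ⟩, hd, hw⟩ := w
    obtain ⟨hφ', hψ'⟩ := Finset.union_subset_iff.1 ((Finset.subset_insert _ _).trans hφ)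
    have ihφ := ihφ hφ' ⟨⟨Γ, Δ⟩, hd, hw⟩
    have ihψ := ihψ hψ' ⟨⟨Γ, Δ⟩, hd, hw⟩
    have hmφ := hw φ (hφ' φ.self_mem_subformulas)
    have hmψ := hw ψ (hψ' ψ.self_mem_subformulas)
    refine ⟨fun h => ⟨ihφ.1 (hmφ.resolve_right fun hΔ => hd ?_),
      ihψ.1 (hmψ.resolve_right fun hΔ => hd ?_)⟩, fun h hsat => hd ?_⟩
    · rw [← Finset.insert_eq_of_mem (s := Γ) h]
      exact .andL₁ [] [] _ _ _ _ (derivable_of_mem (Finset.mem_insert_self _ _) hΔ)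
    · rw [← Finset.insert_eq_of_mem (s := Γ) h]
      exact .andL₂ [] [] _ _ _ _ (derivable_of_mem (Finset.mem_insert_self _ _) hΔ)
    · rw [← Finset.insert_eq_of_mem (s := Δ) h]
      exact .andR [] [] _ _ _ _
        (derivable_of_mem (hmφ.resolve_right fun h' => ihφ.2 h' hsat.1)
          (Finset.mem_insert_self _ _))
        (derivable_of_mem (hmψ.resolve_right fun h' => ihψ.2 h' hsat.2)
          (Finset.mem_insert_self _ _))
  | or φ ψ ihφ ihψ =>
    obtain ⟨⟨Γ, Δ⟩, hd, hw⟩ := w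
    obtain ⟨hφ', hψ'⟩ := Finset.union_subset_iff.1 ((Finset.subset_insert _ _).trans hφ)
    have ihφ := ihφ hφ' ⟨⟨Γ, Δ⟩, hd, hw⟩
    have ihψ := ihψ hψ' ⟨⟨Γ, Δ⟩, hd, hw⟩
    have hmφ := hw φ (hφ' φ.self_mem_subformulas)
    have hmψ := hw ψ (hψ' ψ.self_mem_subformulas)
    refine ⟨fun h => by_contra fun hsat => hd ?_, fun h hsat => hsat.elim
      (ihφ.2 (hmφ.resolve_left fun hΓ => hd ?_)) (ihψ.2 (hmψ.resolve_left fun hΓ => hd ?_))⟩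
    · rw [← Finset.insert_eq_of_mem (s := Γ) h]
      exact .orL [] [] _ _ _ _
        (derivable_of_mem (Finset.mem_insert_self _ _)
          (hmφ.resolve_left fun h' => hsat (.inl (ihφ.1 h'))))
        (derivable_of_mem (Finset.mem_insert_self _ _)
          (hmψ.resolve_left fun h' => hsat (.inr (ihψ.1 h'))))
    · rw [← Finset.insert_eq_of_mem (s := Δ) h]
      exact .orR₁ [] [] _ _ _ _ (derivable_of_mem hΓ (Finset.mem_insert_self _ _))
    · rw [← Finset.insert_eq_of_mem (s := Δ) h]
      exact .orR₂ [] [] _ _ _ _ (derivable_of_mem hΓ (Finset.mem_insert_self _ _))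

theorem exists_countermodel {H : Hypersequent} (h : ¬ RK4Cut H) :
    ∃ F : Finset Formula, (canonicalModel F).IsCountermodel H := by
  obtain ⟨F, hF, hHF⟩ := exists_finset_subformula_closed H
  have hbox : ∀ φ, .box φ ∈ F → φ ∈ F := fun φ hφ =>
    hF _ hφ (Finset.mem_insert_of_mem φ.self_mem_subformulas)
  obtain ⟨H', hsub, hsat, hd⟩ := exists_saturated_of_not_derivable F h
  obtain ⟨ws, rfl, hchain⟩ := exists_branch hbox hd hsat
  refine ⟨F, ws, hchain, ?_⟩
  have hsub' : List.Forall₂ (fun S (w : CanonicalWorld F) => S.Sub w.1) H ws :=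
    List.forall₂_map_right_iff.1 hsub
  refine ((List.forall₂_and_left _ _).2 ⟨hHF, hsub'⟩).imp fun S w ⟨hS, hSw⟩ => ⟨?_, ?_⟩
  · exact fun φ hφ => (truth_lemma hbox φ (hF φ (hS (Finset.mem_union_left _ hφ))) w).1 (hSw.1 hφ)
  · exact fun φ hφ => (truth_lemma hbox φ (hF φ (hS (Finset.mem_union_right _ hφ))) w).2 (hSw.2 hφ)

end RelHyp

/-- Hypersequent completeness of `RK4` with `Cut` for the class of transitive frames. -/
theorem mainTheorem7 (H : RelHyp.Hypersequent) (hH : RelHyp.Valid RelHyp.IsK4Frame H) :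
    RelHyp.RK4Cut H := by
  by_contra h
  obtain ⟨F, hF⟩ := RelHyp.exists_countermodel h
  exact hH _ (RelHyp.isK4Frame_canonicalModel F) hF
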